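/- A \emph{Gödel algebra} is a Heyting algebra satisfying $(x\to y)\vee(y\to x)=1$. A \emph{bi-modal Gödel algebra} is a Gödel algebra $A$ together with unary operations $I,K$ such that, for all $a,b\in A$, $$I(a\wedge b)=Ia\wedge Ib,\quad I1=1,\quad K(a\vee b)=Ka\vee Kb,\quad K0=0,\quad (Ka\to Ib)\le I(a\to b),\quad K(a\to b)\le (Ia\to Kb).$$ Bi-modal formulas over a set $Var$ of variables are built from $Var$ and $\bot$ using $\wedge,\vee,\to,\Box,\Diamond$; a valuation $v:Var\to A$ extends to all formulas by interpreting $\Box,\Diamond$ as $I,K$ and the other connectives by the Heyting operations of $A$. Let $[0,1]$ carry its unique Heyting algebra structure, with implication $\Rightarrow$. A \emph{GK-frame} is a pair $\mathcal F=(W,S)$ with $W$ a non-empty set and $S:W\times W\to[0,1]$ a function. Its \emph{complex algebra} $[0,1]^{\mathcal F}$ is the product Gödel algebra $[0,1]^W$ with $$I(f)(x)=\inf_{y\in W}\bigl(S(x,y)\Rightarrow f(y)\bigr),\qquad K(f)(x)=\sup_{y\in W}\min\bigl(S(x,y),f(y)\bigr);$$ it is a bi-modal Gödel algebra. A \emph{GK-model}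 over $\mathcal F$ is given by a function $e:W\times Var\to[0,1]$, extended to all formulas by evaluating $\bot,\wedge,\vee,\to$ in $[0,1]$ at each world and $$e(x,\Box\varphi)=\inf_{y\in W}\bigl(S(x,y)\Rightarrow e(y,\varphi)\bigr),\qquad e(x,\Diamond\varphi)=\sup_{y\in W}\min\bigl(S(x,y),e(y,\varphi)\bigr);$$ write $(W,S,e)\models\varphi$ if $e(x,\varphi)=1$ for all $x\in W$. \textbf{Theorem.} For every countable (finite or countably infinite) bi-modal Gödel algebra $A$ with $0\neq 1$ there is a GK-frame $\mathcal F_A=(W,S)$ such that: (i) there is an injective homomorphism of bi-modal Gödel algebras $A\to[0,1]^{\mathcal F_A}$; (ii) for every set $Var$ of variables and every valuation $v:Var\to A$ there is a function $e_v:W\times Var\to[0,1]$ such that, for every formula $\varphi$, $v(\varphi)=1$ if and only if $(W,S,e_v)\models\varphi$. -/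

import Mathlib

universe u v w

/-- A Gödel algebra: a Heyting algebra satisfying prelinearity. -/
class GodelAlgebra (A : Type u) extends HeytingAlgebra A where
  prelinearity : ∀ a b : A, (a ⇨ b) ⊔ (b ⇨ a) = ⊤

/-- A bi-modal Gödel algebra: a Gödel algebra with two unary operations `I` and `K` subject to
the six listed identities. -/
class BimodalGodelAlgebra (A : Type u) extends GodelAlgebra A where
  I : A → A
  K : A → A
  I_inf : ∀ a b : A, I (a ⊓ b) = I a ⊓ I b
  I_top : I ⊤ = ⊤
  K_sup : ∀ a b : A, K (a ⊔ b) = K a ⊔ K b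
  K_bot : K ⊥ = ⊥
  K_himp_I_le : ∀ a b : A, K a ⇨ I b ≤ I (a ⇨ b)
  K_himp_le : ∀ a b : A, K (a ⇨ b) ≤ I a ⇨ K b

/-- Homomorphisms of bi-modal Gödel algebras: they preserve meet, join, implication, bottom
(hence top) and both unary operations. -/
structure BimodalGodelHom (A : Type u) (B : Type v) [BimodalGodelAlgebra A]
    [BimodalGodelAlgebra B] extends HeytingHom A B where
  map_I : ∀ a : A, toFun (BimodalGodelAlgebra.I a) = BimodalGodelAlgebra.I (toFun a)
  map_K : ∀ a : A, toFun (BimodalGodelAlgebra.K a) = BimodalGodelAlgebra.K (toFun a)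

/-- Formulas of bi-modal propositional logic over a set `Var` of propositional variables. -/
inductive BimodalFormula (Var : Type w) : Type w where
  | var : Var → BimodalFormula Var
  | bot : BimodalFormula Var
  | and : BimodalFormula Var → BimodalFormula Var → BimodalFormula Var
  | or : BimodalFormula Var → BimodalFormula Var → BimodalFormula Var
  | imp : BimodalFormula Var → BimodalFormula Var → BimodalFormula Var
  | box : BimodalFormula Var → BimodalFormula Var
  | dia : BimodalFormula Var → BimodalFormula Var

/-- The extension of an algebraic valuation `val : Var → A` to all formulas, with `□` and `◇`
interpreted by `I` and `K`. -/
def BimodalFormula.eval {Var : Type w} {A : Type u} [BimodalGodelAlgebra A] (val : Var → A) :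
    BimodalFormula Var → A
  | .var p => val p
  | .bot => ⊥
  | .and φ ψ => φ.eval val ⊓ ψ.eval val
  | .or φ ψ => φ.eval val ⊔ ψ.eval val
  | .imp φ ψ => φ.eval val ⇨ ψ.eval val
  | .box φ => BimodalGodelAlgebra.I (φ.eval val)
  | .dia φ => BimodalGodelAlgebra.K (φ.eval val)

/-- A Gödel-Kripke frame: a non-empty set of worlds with a `[0,1]`-valued accessibility
relation. -/
structure GKFrame : Type (u + 1) where
  World : Type u
  nonempty : Nonempty World
  S : World → World → unitInterval

/-- A Gödel-Kripke model: a GK-frame with a `[0,1]`-valued assignment of the variables at each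
world. -/
structure GKModel (Var : Type w) : Type (max (u + 1) w) extends GKFrame.{u} where
  e : World → Var → unitInterval

/-- The value `e(x, φ)` of a formula at a world. The connectives are those of the order of
`[0,1]`: `⊓` is the minimum, `⊔` the maximum and `a ⇨ b` is `1` if `a ≤ b` and `b` otherwise. -/
noncomputable def GKModel.value {Var : Type w} (M : GKModel.{u, w} Var) :
    M.World → BimodalFormula Var → unitInterval
  | x, .var p => M.e x p
  | _, .bot => ⊥
  | x, .and φ ψ => M.value x φ ⊓ M.value x ψ
  | x, .or φ ψ => M.value x φ ⊔ M.value x ψ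
  | x, .imp φ ψ => M.value x φ ⇨ M.value x ψ
  | x, .box φ => ⨅ y : M.World, (M.S x y ⇨ M.value y φ)
  | x, .dia φ => ⨆ y : M.World, (M.S x y ⊓ M.value y φ)

/-- `φ` is valid in `M` if it has value `1` at every world. -/
def GKModel.Valid {Var : Type w} (M : GKModel.{u, w} Var) (φ : BimodalFormula Var) : Prop :=
  ∀ x : M.World, M.value x φ = 1

/-- The carrier `[0,1]^W` of the complex algebra of a GK-frame. -/
def GKFrame.ComplexAlgebra (F : GKFrame.{u}) : Type u := F.World → unitInterval

/-- The Gödel complex algebra of a GK-frame: the product Gödel algebra `[0,1]^W` with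
`I(f)(x) = inf_y (S x y ⇒ f y)` and `K(f)(x) = sup_y (S x y ∧ f y)`. -/
noncomputable instance GKFrame.instComplexAlgebra (F : GKFrame.{u}) :
    BimodalGodelAlgebra F.ComplexAlgebra where
  toHeytingAlgebra := inferInstanceAs (HeytingAlgebra (F.World → unitInterval))
  prelinearity f g := by
    funext x
    rcases le_total (f x) (g x) with h | h
    · exact top_unique ((himp_eq_top_iff.2 h).ge.trans le_sup_left)
    · exact top_unique ((himp_eq_top_iff.2 h).ge.trans le_sup_right)
  I f := fun x => ⨅ y : F.World, (F.S x y ⇨ f y)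
  K f := fun x => ⨆ y : F.World, (F.S x y ⊓ f y)
  I_inf f g := by
    funext x
    change (⨅ y : F.World, (F.S x y ⇨ f y ⊓ g y)) =
      (⨅ y : F.World, (F.S x y ⇨ f y)) ⊓ ⨅ y : F.World, (F.S x y ⇨ g y)
    simp only [himp_inf_distrib, iInf_inf_eq]
  I_top := by
    funext x
    change (⨅ y : F.World, (F.S x y ⇨ (⊤ : unitInterval))) = ⊤
    simp only [himp_top, iInf_top]
  K_sup f g := by
    funext x
    change (⨆ y : F.World, (F.S x y ⊓ (f y ⊔ g y))) =
      (⨆ y : F.World, (F.S x y ⊓ f y)) ⊔ ⨆ y : F.World, (F.S x y ⊓ g y)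
    simp only [inf_sup_left, iSup_sup_eq]
  K_bot := by
    funext x
    change (⨆ y : F.World, (F.S x y ⊓ (⊥ : unitInterval))) = ⊥
    simp only [inf_bot_eq, iSup_bot]
  K_himp_I_le f g := by
    intro x
    change (⨆ y : F.World, (F.S x y ⊓ f y)) ⇨ (⨅ y : F.World, (F.S x y ⇨ g y)) ≤
      ⨅ y : F.World, (F.S x y ⇨ (f y ⇨ g y))
    refine le_iInf fun y => ?_
    rw [himp_himp, le_himp_iff]
    have h1 : F.S x y ⊓ f y ≤ ⨆ y : F.World, (F.S x y ⊓ f y) :=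
      le_iSup (fun y => F.S x y ⊓ f y) y
    have h2 : (⨅ y : F.World, (F.S x y ⇨ g y)) ≤ F.S x y ⇨ g y :=
      iInf_le (fun y => F.S x y ⇨ g y) y
    have h3 := (himp_le_himp h1 h2)
    rw [himp_himp, le_himp_iff] at h3
    exact le_trans (inf_le_inf le_rfl (le_inf le_rfl inf_le_left)) h3
  K_himp_le f g := by
    intro x
    change (⨆ y : F.World, (F.S x y ⊓ (f y ⇨ g y))) ≤
      (⨅ y : F.World, (F.S x y ⇨ f y)) ⇨ ⨆ y : F.World, (F.S x y ⊓ g y)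
    refine iSup_le fun y => ?_
    rw [le_himp_iff]
    refine le_trans ?_ (le_iSup (fun y => F.S x y ⊓ g y) y)
    have h2 : (⨅ y : F.World, (F.S x y ⇨ f y)) ≤ F.S x y ⇨ f y :=
      iInf_le (fun y => F.S x y ⇨ f y) y
    have hS : F.S x y ⊓ (f y ⇨ g y) ⊓ (⨅ y : F.World, (F.S x y ⇨ f y)) ≤ F.S x y :=
      inf_le_left.trans inf_le_left
    have hf : F.S x y ⊓ (f y ⇨ g y) ⊓ (⨅ y : F.World, (F.S x y ⇨ f y)) ≤ f y :=
      le_trans (le_inf (inf_le_right.trans h2) hS) himp_inf_le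
    exact le_inf hS (le_trans (le_inf (inf_le_left.trans inf_le_right) hf) himp_inf_le)

/-! A world is a pair (v, β): a homomorphism v from A into a large chain L, and a label β in L, the
degree at which it may be seen. World (w, β) is accessible from (v, _) when β ⊓ v(Ib) ≤ w(b) and β ⊓
w(b) ≤ v(Kb) for all b. These inequalities give the easy halves of the clauses for I and K; the
other halves need witnesses.

Witnesses come from prime filters. If P contains every x with β ≤ v(Ix), and β ≤ v(Kx) on all of P,
the two mixed axioms say exactly that the bounds β ⊓ v(Ix) and β ⊓ v(Kx) are compatible with the
order of A/P. Since A is countable and L countably saturated (an ultrapower of [0,1]), A/P can be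
placed between these bounds (`exists_strictMono_between`), and sending P to ⊤ yields an accessible
homomorphism. For K the supremum is attained, at degree v(Ka). For I the infimum is only approached:
w(a) can be brought below any given ε > v(Ia).

Closing under witnesses keeps the set of worlds countable, so the labels, among which are all
values, form a countable D ⊆ L. D embeds into [0,1] continuously from the right, which preserves the
approached infima. Evaluation of A at the worlds is then the required embedding, injective because
homomorphisms into L separate nonunits from ⊤; the claim about formulas follows by induction on
them. -/

/-! ### Countably saturated chains -/

/-- A linear order in which every countable cut is strictly filled. -/
def CountablySaturated (L : Type*) [LT L] : Prop :=
  ∀ c d : ℕ → L, (∀ i j, c i < d j) → ∃ x, ∀ i, c i < x ∧ x < d i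

theorem exists_between_of_finset {α : Type*} [LinearOrder α] [DenselyOrdered α] {s t : Finset α}
    (hs : s.Nonempty) (ht : t.Nonempty) (h : ∀ a ∈ s, ∀ b ∈ t, a < b) :
    ∃ x, (∀ a ∈ s, a < x) ∧ ∀ b ∈ t, x < b := by
  obtain ⟨x, h1, h2⟩ := exists_between (h _ (s.max'_mem hs) _ (t.min'_mem ht))
  exact ⟨x, fun a ha => (s.le_max' a ha).trans_lt h1, fun b hb => h2.trans_le (t.min'_le b hb)⟩

/-- Ultrapowers over `ℕ` of dense linear orders are countably saturated. -/
theorem germ_countablySaturated {α : Type*} [LinearOrder α] [DenselyOrdered α] [Nonempty α] :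
    CountablySaturated (Filter.Germ (Filter.hyperfilter ℕ : Filter ℕ) α) := by
  classical
  intro c d h
  have hc : ∀ i, ∃ f : ℕ → α, (f : Filter.Germ (Filter.hyperfilter ℕ : Filter ℕ) α) = c i :=
    fun i => Quotient.exists_rep (c i)
  have hd : ∀ i, ∃ f : ℕ → α, (f : Filter.Germ (Filter.hyperfilter ℕ : Filter ℕ) α) = d i :=
    fun i => Quotient.exists_rep (d i)
  choose f hf using hc
  choose g hg using hd
  have hfg : ∀ i j, ∀ᶠ k in (Filter.hyperfilter ℕ : Filter ℕ), f i k < g j k := by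
    intro i j
    have := h i j
    rw [← hf, ← hg] at this
    exact Filter.Germ.coe_lt.1 this
  -- Diagonal argument: coordinate `k` respects only the constraints with index at most `k` that are
  -- consistent there. For fixed `n` this includes constraint `n` at almost every `k`.
  let good : ℕ → ℕ → Prop := fun k n => ∀ i ≤ n, ∀ j ≤ n, f i k < g j k
  have key : ∀ k, ∃ x, ∀ n ≤ k, good k n → f n k < x ∧ x < g n k := by
    intro k
    by_cases h0 : good k 0
    · let s : Finset ℕ := (Finset.range (k + 1)).filter (good k)
      have hs : 0 ∈ s := by simp [s, h0]
      obtain ⟨x, h1, h2⟩ := exists_between_of_finset (s := s.image fun i => f i k)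
        (t := s.image fun i => g i k) ⟨_, Finset.mem_image_of_mem _ hs⟩
        ⟨_, Finset.mem_image_of_mem _ hs⟩ (by
          simp only [Finset.mem_image, forall_exists_index, and_imp, forall_apply_eq_imp_iff₂]
          intro i hi j hj
          have hi' : good k i := (Finset.mem_filter.1 hi).2
          have hj' : good k j := (Finset.mem_filter.1 hj).2
          rcases le_total i j with hij | hij
          · exact hj' i hij j le_rfl
          · exact hi' i le_rfl j hij)
      refine ⟨x, fun n hn hg => ?_⟩
      have hns : n ∈ s := by simp only [s, Finset.mem_filter, Finset.mem_range]; exact ⟨by omega, hg⟩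
      exact ⟨h1 _ (Finset.mem_image_of_mem _ hns), h2 _ (Finset.mem_image_of_mem _ hns)⟩
    · refine ⟨Classical.arbitrary α, fun n _ hg => (h0 ?_).elim⟩
      intro i hi j hj
      exact hg i (by omega) j (by omega)
  choose x hx using key
  have hev : ∀ n, ∀ᶠ k in (Filter.hyperfilter ℕ : Filter ℕ), f n k < x k ∧ x k < g n k := by
    intro n
    have h1 : ∀ᶠ k in (Filter.hyperfilter ℕ : Filter ℕ), n ≤ k := by
      have := Filter.hyperfilter_le_cofinite (α := ℕ)
      rw [Nat.cofinite_eq_atTop] at this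
      exact this (Filter.eventually_ge_atTop n)
    have h2 : ∀ᶠ k in (Filter.hyperfilter ℕ : Filter ℕ), good k n := by
      have : ∀ᶠ k in (Filter.hyperfilter ℕ : Filter ℕ),
          ∀ p ∈ Finset.range (n + 1) ×ˢ Finset.range (n + 1), f p.1 k < g p.2 k :=
        (Filter.eventually_all_finset _).2 fun p _ => hfg p.1 p.2
      filter_upwards [this] with k hk i hi j hj
      exact hk (i, j) (by simp; omega)
    filter_upwards [h1, h2] with k hk1 hk2
    exact hx k n hk1 hk2
  refine ⟨(x : Filter.Germ (Filter.hyperfilter ℕ : Filter ℕ) α), fun n => ?_⟩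
  rw [← hf, ← hg]
  exact ⟨Filter.Germ.coe_lt.2 ((hev n).mono fun _ h => h.1),
    Filter.Germ.coe_lt.2 ((hev n).mono fun _ h => h.2)⟩

theorem CountablySaturated.exists_between_sets {L : Type*} [LinearOrder L]
    (hL : CountablySaturated L) {s t : Set L} (hs : s.Countable) (ht : t.Countable)
    (hs' : s.Nonempty) (ht' : t.Nonempty) (h : ∀ a ∈ s, ∀ b ∈ t, a < b) :
    ∃ x, (∀ a ∈ s, a < x) ∧ ∀ b ∈ t, x < b := by
  obtain ⟨c, rfl⟩ := hs.exists_eq_range hs'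
  obtain ⟨d, rfl⟩ := ht.exists_eq_range ht'
  obtain ⟨x, hx⟩ := hL c d fun i j => h _ ⟨i, rfl⟩ _ ⟨j, rfl⟩
  exact ⟨x, by rintro _ ⟨i, rfl⟩; exact (hx i).1, by rintro _ ⟨i, rfl⟩; exact (hx i).2⟩

/-! ### Strictly monotone maps between prescribed bounds -/

section Placement

variable {Y L : Type*} [LinearOrder L] (r : Y → Y → Prop)

/-- `(y, ℓ)` below and `(z, u)` above are compatible with the preorder `r`: as bounds for a
strictly `r`-monotone function, `ℓ` at `y` does not exceed `u` at `z`. -/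
def BoundsCompatible (lower upper : Set (Y × L)) : Prop :=
  ∀ p ∈ lower, ∀ q ∈ upper, (r p.1 q.1 → p.2 ≤ q.2) ∧ (¬ r q.1 p.1 → p.2 < q.2)

/-- A value at one further point can be added to compatible countable sets of bounds. -/
theorem BoundsCompatible.exists_value (hL : CountablySaturated L)
    (hrefl : ∀ x, r x x) (htrans : ∀ x y z, r x y → r y z → r x z) (htotal : ∀ x y, r x y ∨ r y x)
    {lower upper : Set (Y × L)} (hl : lower.Countable) (hu : upper.Countable)
    (h : BoundsCompatible r lower upper) (x : Y) (hlx : ∃ ℓ, (x, ℓ) ∈ lower)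
    (hux : ∃ u, (x, u) ∈ upper) :
    ∃ t, BoundsCompatible r (insert (x, t) lower) (insert (x, t) upper) := by
  suffices H : ∃ t, (∀ p ∈ lower, (r p.1 x → p.2 ≤ t) ∧ (¬ r x p.1 → p.2 < t)) ∧
      ∀ q ∈ upper, (r x q.1 → t ≤ q.2) ∧ (¬ r q.1 x → t < q.2) by
    obtain ⟨t, h1, h2⟩ := H
    refine ⟨t, ?_⟩
    rintro p (rfl | hp) q (rfl | hq)
    · exact ⟨fun _ => le_rfl, fun h => (h (hrefl _)).elim⟩
    · exact h2 q hq
    · exact h1 p hp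
    · exact h p hp q hq
  -- Either a lower and an upper bound meet and force the value at `x`, or all bounds relevant at
  -- `x` are strictly separated and saturation fills the gap.
  by_cases hex : ∃ p ∈ lower, ∃ q ∈ upper, r p.1 x ∧ r x q.1 ∧ q.2 ≤ p.2
  · obtain ⟨p, hp, q, hq, hpx, hxq, hqp⟩ := hex
    have hqp1 : r q.1 p.1 := by
      by_contra hn
      exact absurd ((h p hp q hq).2 hn) (not_lt.2 hqp)
    refine ⟨p.2, fun p' hp' => ⟨fun h1 => ?_, fun h1 => ?_⟩, fun q' hq' => ⟨fun h1 => ?_, fun h1 => ?_⟩⟩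
    · exact ((h p' hp' q hq).1 (htrans _ _ _ h1 hxq)).trans hqp
    · exact ((h p' hp' q hq).2 fun h2 => h1 (htrans _ _ _ hxq h2)).trans_le hqp
    · exact (h p hp q' hq').1 (htrans _ _ _ hpx h1)
    · exact (h p hp q' hq').2 fun h2 => h1 (htrans _ _ _ h2 hpx)
  · push Not at hex
    obtain ⟨ℓ, hℓ⟩ := hlx
    obtain ⟨m, hm⟩ := hux
    obtain ⟨t, h1, h2⟩ := hL.exists_between_sets
      (s := Prod.snd '' {p ∈ lower | r p.1 x}) (t := Prod.snd '' {q ∈ upper | r x q.1})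
      ((hl.mono fun _ h => h.1).image _) ((hu.mono fun _ h => h.1).image _)
      ⟨_, _, ⟨hℓ, hrefl x⟩, rfl⟩ ⟨_, _, ⟨hm, hrefl x⟩, rfl⟩ (by
        rintro _ ⟨p, ⟨hp, hpx⟩, rfl⟩ _ ⟨q, ⟨hq, hxq⟩, rfl⟩
        exact hex p hp q hq hpx hxq)
    have h1' : ∀ p ∈ lower, r p.1 x → p.2 < t := fun p hp hpx => h1 _ ⟨p, ⟨hp, hpx⟩, rfl⟩
    have h2' : ∀ q ∈ upper, r x q.1 → t < q.2 := fun q hq hq' => h2 _ ⟨q, ⟨hq, hq'⟩, rfl⟩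
    exact ⟨t, fun p hp => ⟨fun hr => (h1' p hp hr).le,
        fun hr => h1' p hp ((htotal _ _).resolve_right hr)⟩,
      fun q hq => ⟨fun hr => (h2' q hq hr).le,
        fun hr => h2' q hq ((htotal _ _).resolve_right hr)⟩⟩

/-- A countable total preorder maps strictly monotonically into a countably saturated chain,
between prescribed compatible bounds. -/
theorem exists_strictMono_between [Countable Y] (hL : CountablySaturated L)
    (hrefl : ∀ x, r x x) (htrans : ∀ x y z, r x y → r y z → r x z) (htotal : ∀ x y, r x y ∨ r y x)
    (lo hi : Y → L) (hle : ∀ x y, r x y → lo x ≤ hi y) (hlt : ∀ x y, ¬ r y x → lo x < hi y) :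
    ∃ f : Y → L, (∀ x y, f x ≤ f y ↔ r x y) ∧ ∀ x, lo x ≤ f x ∧ f x ≤ hi x := by
  let Lo : Set (Y × L) := Set.range fun y => (y, lo y)
  let Hi : Set (Y × L) := Set.range fun y => (y, hi y)
  -- `T` serves as lower and as upper bounds at once, so compatibility makes it the graph of a
  -- strictly monotone partial function. It is countable because `Y` is, so a maximal one is total.
  obtain ⟨T, hT⟩ := zorn_subset {T : Set (Y × L) | BoundsCompatible r (Lo ∪ T) (Hi ∪ T)} (by
    intro c hc hchain
    rcases c.eq_empty_or_nonempty with rfl | ⟨T₀, hT₀⟩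
    · refine ⟨∅, ?_, by simp⟩
      rintro p (⟨x, rfl⟩ | hp) q (⟨y, rfl⟩ | hq)
      · exact ⟨hle x y, hlt x y⟩
      · exact hq.elim
      · exact hp.elim
      · exact hp.elim
    · refine ⟨⋃₀ c, ?_, fun s hs => Set.subset_sUnion_of_mem hs⟩
      have aux : ∀ (S : Set (Y × L)) (p : Y × L), p ∈ S ∪ ⋃₀ c → ∃ T ∈ c, p ∈ S ∪ T := by
        rintro S p (hp | ⟨T, hT, hp⟩)
        · exact ⟨T₀, hT₀, Or.inl hp⟩
        · exact ⟨T, hT, Or.inr hp⟩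
      intro p hp q hq
      obtain ⟨T₁, hT₁, hp⟩ := aux _ _ hp
      obtain ⟨T₂, hT₂, hq⟩ := aux _ _ hq
      rcases hchain.total hT₁ hT₂ with h12 | h12
      · exact hc hT₂ p (Set.union_subset_union_right _ h12 hp) q hq
      · exact hc hT₁ p hp q (Set.union_subset_union_right _ h12 hq))
  have hgood : BoundsCompatible r (Lo ∪ T) (Hi ∪ T) := hT.1
  have hTcount : T.Countable := by
    have hinj : Set.InjOn Prod.fst T := by
      rintro ⟨x, s⟩ hs ⟨y, t⟩ ht (rfl : x = y)
      have h1 := (hgood _ (Or.inr hs) _ (Or.inr ht)).1 (hrefl x)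
      have h2 := (hgood _ (Or.inr ht) _ (Or.inr hs)).1 (hrefl x)
      exact Prod.ext rfl (le_antisymm h1 h2)
    exact Set.MapsTo.countable_of_injOn (Set.mapsTo_univ _ _) hinj Set.countable_univ
  have hall : ∀ x, ∃ t, (x, t) ∈ T := by
    intro x
    obtain ⟨t, ht⟩ := BoundsCompatible.exists_value r hL hrefl htrans htotal
      ((Set.countable_range _).union hTcount) ((Set.countable_range _).union hTcount) hgood x
      ⟨lo x, Or.inl ⟨x, rfl⟩⟩ ⟨hi x, Or.inl ⟨x, rfl⟩⟩
    refine ⟨t, ?_⟩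
    rw [← Set.union_insert, ← Set.union_insert] at ht
    exact hT.2 ht (Set.subset_insert _ _) (Set.mem_insert _ _)
  choose f hf using hall
  refine ⟨f, fun x y => ⟨fun h => ?_, fun h => ?_⟩, fun x => ⟨?_, ?_⟩⟩
  · by_contra hn
    exact absurd ((hgood _ (Or.inr (hf y)) _ (Or.inr (hf x))).2 hn) (not_lt.2 h)
  · exact (hgood _ (Or.inr (hf x)) _ (Or.inr (hf y))).1 h
  · exact (hgood _ (Or.inl ⟨x, rfl⟩) _ (Or.inr (hf x))).1 (hrefl x)
  · exact (hgood _ (Or.inr (hf x)) _ (Or.inl ⟨x, rfl⟩)).1 (hrefl x)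

end Placement

/-! ### Countable closure and the embedding into the unit interval -/

/-- Countable sets can be closed under countably many binary operations. -/
theorem exists_countable_closed {X : Type*} (ops : Set (X → X → X)) (hops : ops.Countable)
    (S : Set X) (hS : S.Countable) :
    ∃ C, S ⊆ C ∧ C.Countable ∧ ∀ f ∈ ops, ∀ x ∈ C, ∀ y ∈ C, f x y ∈ C := by
  let step : Set X → Set X := fun T => T ∪ ⋃ f ∈ ops, Set.image2 f T T
  let C : ℕ → Set X := fun n => step^[n] S
  have hsucc : ∀ n, C (n + 1) = step (C n) := fun n => Function.iterate_succ_apply' step n S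
  have hmono : Monotone C := monotone_nat_of_le_succ fun n => by
    rw [hsucc]; exact Set.subset_union_left
  have hcount : ∀ n, (C n).Countable := by
    intro n
    induction n with
    | zero => exact hS
    | succ n ih =>
      rw [hsucc]
      exact ih.union (hops.biUnion fun f _ => ih.image2 ih f)
  refine ⟨⋃ n, C n, Set.subset_iUnion C 0, Set.countable_iUnion hcount, ?_⟩
  intro f hf x hx y hy
  obtain ⟨m, hm⟩ := Set.mem_iUnion.1 hx
  obtain ⟨n, hn⟩ := Set.mem_iUnion.1 hy
  refine Set.mem_iUnion.2 ⟨max m n + 1, ?_⟩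
  rw [hsucc]
  exact Or.inr (Set.mem_biUnion hf ⟨x, hmono (le_max_left m n) hm, y, hmono (le_max_right m n) hn, rfl⟩)

/-- A countable subset of a bounded chain embeds into `[0,1]` preserving the endpoints and such
that the embedding is continuous from the right. -/
theorem exists_rightContinuous_embedding {L : Type*} [LinearOrder L] [BoundedOrder L]
    [Nontrivial L] (D : Set L) (hD : D.Countable) (htop : ⊤ ∈ D) :
    ∃ g : L → unitInterval, StrictMonoOn g D ∧ g ⊥ = ⊥ ∧ g ⊤ = ⊤ ∧
      ∀ d ∈ D, d ≠ ⊤ → ∀ s, g d < s → ∃ ε ∈ D, d < ε ∧ ∀ x, x < ε → g x < s := by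
  classical
  -- Here `g x` is the total weight of the `e k ≤ x`. Omitting `⊥` gives `g ⊥ = 0`, and weights of
  -- sum 1 give `g ⊤ = 1`.
  obtain ⟨e, he⟩ := (hD.mono (Set.sdiff_subset (t := {⊥}))).exists_eq_range
    ⟨⊤, htop, top_ne_bot⟩
  have heD : ∀ k, e k ∈ D ∧ e k ≠ ⊥ := fun k => by
    have : e k ∈ D \ {⊥} := he ▸ ⟨k, rfl⟩
    exact this
  let a : ℕ → ℝ := fun k => 1 / 2 / 2 ^ k
  have ha : HasSum a 1 := hasSum_geometric_two' 1
  have ha0 : ∀ k, 0 < a k := fun k => by positivity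
  let b : L → ℕ → ℝ := fun x k => if e k ≤ x then a k else 0
  have hb0 : ∀ x k, 0 ≤ b x k := fun x k => by
    simp only [b]; split_ifs; exacts [(ha0 k).le, le_rfl]
  have hba : ∀ x k, b x k ≤ a k := fun x k => by
    simp only [b]; split_ifs; exacts [le_rfl, (ha0 k).le]
  have hbs : ∀ x, Summable (b x) := fun x => Summable.of_nonneg_of_le (hb0 x) (hba x) ha.summable
  have hbm : ∀ x y, x ≤ y → ∀ k, b x k ≤ b y k := fun x y hxy k => by
    simp only [b]
    split_ifs with h1 h2
    exacts [le_rfl, (h2 (h1.trans hxy)).elim, (ha0 k).le, le_rfl]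
  let g : L → unitInterval := fun x => ⟨∑' k, b x k, tsum_nonneg (hb0 x),
    (Summable.tsum_le_tsum (hba x) (hbs x) ha.summable).trans ha.tsum_eq.le⟩
  refine ⟨g, ?_, ?_, ?_, ?_⟩
  · intro x hx y hy hxy
    have : y ∈ Set.range e := he ▸ ⟨hy, (bot_le.trans_lt hxy).ne'⟩
    obtain ⟨k, rfl⟩ := this
    refine Subtype.mk_lt_mk.2 (Summable.tsum_lt_tsum (i := k) (hbm _ _ hxy.le) ?_ (hbs _) (hbs _))
    simp only [b, if_neg hxy.not_ge, if_pos le_rfl]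
    exact ha0 k
  · refine Subtype.ext ?_
    change ∑' k, b ⊥ k = 0
    have : b ⊥ = 0 := funext fun k => if_neg fun h => (heD k).2 (le_bot_iff.1 h)
    rw [this]
    exact tsum_zero
  · refine Subtype.ext ?_
    change ∑' k, b ⊤ k = 1
    have : b ⊤ = a := funext fun k => if_pos le_top
    rw [this, ha.tsum_eq]
  · intro d hd hdtop s hs
    have hs' : 0 < (s : ℝ) - g d := sub_pos.2 hs
    have htail := (tendsto_sum_nat_add a).eventually (gt_mem_nhds hs')
    obtain ⟨N, hN⟩ := htail.exists
    -- Only the first `N` jumps are too large to ignore; below the least of them beyond `d`, `g`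
    -- exceeds `g d` by at most the tail. Adding `⊤` keeps `F` nonempty.
    let F : Finset L := insert ⊤ (((Finset.range N).image e).filter (d < ·))
    have hF : ∀ x ∈ F, x ∈ D ∧ d < x := by
      intro x hx
      rcases Finset.mem_insert.1 hx with rfl | hx
      · exact ⟨htop, lt_top_iff_ne_top.2 hdtop⟩
      · obtain ⟨hx1, hx2⟩ := Finset.mem_filter.1 hx
        obtain ⟨k, _, rfl⟩ := Finset.mem_image.1 hx1
        exact ⟨(heD k).1, hx2⟩
    have hne : F.Nonempty := ⟨⊤, Finset.mem_insert_self _ _⟩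
    refine ⟨F.min' hne, (hF _ (F.min'_mem hne)).1, (hF _ (F.min'_mem hne)).2, fun x hx => ?_⟩
    have hfirst : ∑ k ∈ Finset.range N, b x k ≤ ∑ k ∈ Finset.range N, b d k := by
      refine Finset.sum_le_sum fun k hk => ?_
      by_cases h1 : e k ≤ x
      · have h2 : e k ≤ d := by
          by_contra h3
          have : e k ∈ F := Finset.mem_insert_of_mem (Finset.mem_filter.2
            ⟨Finset.mem_image_of_mem _ hk, not_le.1 h3⟩)
          exact absurd (hx.trans_le (F.min'_le _ this)) (not_lt.2 h1)
        simp [b, h1, h2]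
      · simp only [b, if_neg h1]
        exact hb0 d k
    have hx1 := (hbs x).sum_add_tsum_nat_add N
    have hd1 := (hbs d).sum_add_tsum_nat_add N
    have htl : ∑' k, b x (k + N) ≤ ∑' k, a (k + N) :=
      Summable.tsum_le_tsum (fun k => hba x _) ((summable_nat_add_iff N).2 (hbs x))
        ((summable_nat_add_iff N).2 ha.summable)
    have hdl : 0 ≤ ∑' k, b d (k + N) := tsum_nonneg fun k => hb0 d _
    have hgd : (g d : ℝ) = ∑' k, b d k := rfl
    refine Subtype.coe_lt_coe.1 ?_
    change ∑' k, b x k < (s : ℝ)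
    linarith

/-! ### Prime filters and homomorphisms into chains -/

section Valuations

variable {A : Type u} {L : Type v}

/-- A prime filter. -/
structure IsPrimeFilterSet [HeytingAlgebra A] (P : Set A) : Prop where
  bot_notMem : ⊥ ∉ P
  top_mem : ⊤ ∈ P
  mem_of_le : ∀ {x y}, x ∈ P → x ≤ y → y ∈ P
  inf_mem : ∀ {x y}, x ∈ P → y ∈ P → x ⊓ y ∈ P
  mem_or_mem : ∀ {x y}, x ⊔ y ∈ P → x ∈ P ∨ y ∈ P

theorem exists_isPrimeFilterSet [HeytingAlgebra A] (F I : Set A)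
    (hFtop : ⊤ ∈ F) (hFle : ∀ {x y}, x ∈ F → x ≤ y → y ∈ F)
    (hFinf : ∀ {x y}, x ∈ F → y ∈ F → x ⊓ y ∈ F)
    (hIbot : ⊥ ∈ I) (hIle : ∀ {x y}, y ∈ I → x ≤ y → x ∈ I)
    (hIsup : ∀ {x y}, x ∈ I → y ∈ I → x ⊔ y ∈ I)
    (hdisj : ∀ x ∈ F, x ∉ I) :
    ∃ P : Set A, IsPrimeFilterSet P ∧ F ⊆ P ∧ ∀ x ∈ P, x ∉ I := by
  have hF : Order.IsPFilter F := Order.IsPFilter.of_def ⟨⊤, hFtop⟩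
    (fun x hx y hy => ⟨x ⊓ y, hFinf hx hy, inf_le_left, inf_le_right⟩) (fun h1 h2 => hFle h2 h1)
  let I' : Order.Ideal A := ⟨⟨I, fun x y h hx => hIle hx h⟩, ⟨⊥, hIbot⟩,
    fun x hx y hy => ⟨x ⊔ y, hIsup hx hy, le_sup_left, le_sup_right⟩⟩
  obtain ⟨J, hJ, hIJ, hFJ⟩ := DistribLattice.prime_ideal_of_disjoint_filter_ideal
    (F := hF.toPFilter) (I := I') (Set.disjoint_left.2 hdisj)
  have hFJ' : ∀ x ∈ F, x ∉ J := fun x hx => Set.disjoint_left.1 hFJ hx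
  refine ⟨{x | x ∉ J}, ⟨?_, hFJ' _ hFtop, ?_, ?_, ?_⟩, hFJ', fun x hx hxI => hx (hIJ hxI)⟩
  · exact fun h => h J.bot_mem
  · exact fun hx hxy hy => hx (J.lower hxy hy)
  · exact fun hx hy hxy => (hJ.mem_or_mem hxy).elim hx hy
  · intro x y hxy
    by_contra hn
    simp only [Set.mem_ofPred_eq, not_or, not_not] at hn
    exact hxy (J.sup_mem hn.1 hn.2)

/-- A homomorphism of Heyting algebras into a bounded chain. -/
structure IsChainValuation [HeytingAlgebra A] [LinearOrder L] [BoundedOrder L] (v : A → L) :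
    Prop where
  map_bot : v ⊥ = ⊥
  map_inf : ∀ x y, v (x ⊓ y) = v x ⊓ v y
  map_sup : ∀ x y, v (x ⊔ y) = v x ⊔ v y
  map_himp_of_le : ∀ {x y}, v x ≤ v y → v (x ⇨ y) = ⊤
  map_himp_of_lt : ∀ {x y}, v y < v x → v (x ⇨ y) = v y

namespace IsChainValuation

variable [HeytingAlgebra A] [LinearOrder L] [BoundedOrder L] {v : A → L}

theorem map_top (hv : IsChainValuation v) : v ⊤ = ⊤ := by
  have := hv.map_himp_of_le (le_refl (v ⊥))
  rwa [himp_self] at this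

theorem mono (hv : IsChainValuation v) {x y : A} (h : x ≤ y) : v x ≤ v y := by
  have := hv.map_inf x y
  rw [inf_eq_left.2 h] at this
  exact inf_eq_left.1 this.symm

theorem le_of_le_himp (hv : IsChainValuation v) {β : L} {x y : A} (h : β ≤ v (x ⇨ y)) :
    β ⊓ v x ≤ v y := by
  refine (inf_le_inf_right _ h).trans ?_
  rw [← hv.map_inf]
  exact hv.mono himp_inf_le

end IsChainValuation

namespace IsPrimeFilterSet

variable [GodelAlgebra A] {P : Set A}

theorem mem_of_himp_mem (hP : IsPrimeFilterSet P) {x y : A} (hx : x ∈ P) (h : x ⇨ y ∈ P) : y ∈ P :=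
  hP.mem_of_le (hP.inf_mem h hx) himp_inf_le

theorem himp_refl (hP : IsPrimeFilterSet P) (x : A) : x ⇨ x ∈ P := by
  rw [himp_self]; exact hP.top_mem

theorem himp_mem_of_le (hP : IsPrimeFilterSet P) {x y : A} (h : x ≤ y) : x ⇨ y ∈ P := by
  rw [himp_eq_top_iff.2 h]; exact hP.top_mem

theorem himp_mem_of_mem (hP : IsPrimeFilterSet P) {x y : A} (h : y ∈ P) : x ⇨ y ∈ P :=
  hP.mem_of_le h le_himp

theorem himp_trans (hP : IsPrimeFilterSet P) (x y z : A) (h1 : x ⇨ y ∈ P) (h2 : y ⇨ z ∈ P) :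
    x ⇨ z ∈ P :=
  hP.mem_of_le (hP.inf_mem h1 h2) (himp_triangle x y z)

theorem himp_total (hP : IsPrimeFilterSet P) (x y : A) : x ⇨ y ∈ P ∨ y ⇨ x ∈ P :=
  hP.mem_or_mem (by rw [GodelAlgebra.prelinearity]; exact hP.top_mem)

variable [LinearOrder L] [BoundedOrder L]

/-- An order embedding of the chain `A / P` into a bounded chain is a homomorphism. -/
theorem isChainValuation (hP : IsPrimeFilterSet P) {f : A → L}
    (hf : ∀ x y, f x ≤ f y ↔ x ⇨ y ∈ P) (hbot : f ⊥ = ⊥) (htop : ∀ x ∈ P, f x = ⊤) :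
    IsChainValuation f where
  map_bot := hbot
  map_inf x y := by
    have hmono : ∀ {x y : A}, x ≤ y → f x ≤ f y := fun h => (hf _ _).2 (hP.himp_mem_of_le h)
    refine le_antisymm (le_inf (hmono inf_le_left) (hmono inf_le_right)) ?_
    rcases hP.himp_total x y with h | h
    · refine inf_le_left.trans ((hf _ _).2 ?_)
      rwa [himp_inf_distrib, himp_self, top_inf_eq]
    · refine inf_le_right.trans ((hf _ _).2 ?_)
      rwa [himp_inf_distrib, himp_self, inf_top_eq]
  map_sup x y := by
    have hmono : ∀ {x y : A}, x ≤ y → f x ≤ f y := fun h => (hf _ _).2 (hP.himp_mem_of_le h)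
    refine le_antisymm ?_ (sup_le (hmono le_sup_left) (hmono le_sup_right))
    rcases hP.himp_total x y with h | h
    · refine le_sup_of_le_right ((hf _ _).2 ?_)
      rwa [sup_himp_distrib, himp_self, inf_top_eq]
    · refine le_sup_of_le_left ((hf _ _).2 ?_)
      rwa [sup_himp_distrib, himp_self, top_inf_eq]
  map_himp_of_le h := htop _ ((hf _ _).1 h)
  map_himp_of_lt {x y} h := by
    have hn : x ⇨ y ∉ P := fun h' => absurd ((hf _ _).2 h') (not_le.2 h)
    refine le_antisymm ((hf _ _).2 ?_) ((hf _ _).2 (hP.himp_mem_of_le le_himp))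
    -- By totality the alternative is `x ⇨ (x ⇨ y) ∈ P`, which contracts to the excluded `x ⇨ y ∈
    -- P`.
    have h1 : (x ⇨ y) ⇨ x ∈ P := by
      refine (hP.himp_total (x ⇨ y) x).resolve_right fun h2 => hn ?_
      rwa [himp_himp, inf_idem] at h2
    refine hP.mem_of_le h1 ?_
    rw [le_himp_iff]
    have h2 : ((x ⇨ y) ⇨ x) ⊓ (x ⇨ y) ≤ x := himp_inf_le
    exact (le_inf inf_le_right h2).trans himp_inf_le

end IsPrimeFilterSet

/-- A nonunit of a countable Gödel algebra is separated from the unit by a homomorphism into a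
countably saturated chain. -/
theorem exists_isChainValuation_ne_top [GodelAlgebra A] [Countable A] [LinearOrder L]
    [BoundedOrder L] [Nontrivial L] (hL : CountablySaturated L) {c : A} (hc : c ≠ ⊤) :
    ∃ v : A → L, IsChainValuation v ∧ v c ≠ ⊤ := by
  classical
  obtain ⟨P, hP, -, hcP⟩ := exists_isPrimeFilterSet (A := A) {⊤} {x | x ≤ c} rfl
    (by rintro x y rfl h; exact top_le_iff.1 h) (by rintro x y rfl rfl; exact inf_idem _)
    bot_le (fun h1 h2 => h2.trans h1) (fun h1 h2 => sup_le h1 h2)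
    (by rintro x rfl h; exact hc (top_le_iff.1 h))
  have hbot : ∀ {x}, x ∈ P → x ⇨ ⊥ ∉ P := fun hx h => hP.bot_notMem (hP.mem_of_himp_mem hx h)
  obtain ⟨f, hf, hf'⟩ := exists_strictMono_between (L := L) (fun x y : A => x ⇨ y ∈ P) hL
    hP.himp_refl hP.himp_trans hP.himp_total
    -- These bounds only pin the two end classes of A/P to `⊤` and `⊥`.
    (fun x => if x ∈ P then ⊤ else ⊥) (fun x => if x ⇨ ⊥ ∈ P then ⊥ else ⊤)
    (by
      intro x y h
      by_cases hx : x ∈ P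
      · rw [if_neg (hbot (hP.mem_of_himp_mem hx h))]; exact le_top
      · rw [if_neg hx]; exact bot_le)
    (by
      intro x y h
      rw [if_neg fun hx => h (hP.himp_mem_of_mem hx),
        if_neg fun hy => h (hP.himp_trans _ _ _ hy (hP.himp_mem_of_le bot_le))]
      exact bot_lt_top)
  have htop : ∀ x ∈ P, f x = ⊤ := fun x hx => by
    have := (hf' x).1
    rw [if_pos hx] at this
    exact top_le_iff.1 this
  refine ⟨f, hP.isChainValuation hf ?_ htop, fun h => hcP c ?_ le_rfl⟩
  · have := (hf' ⊥).2
    rw [if_pos (hP.himp_refl ⊥)] at this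
    exact le_bot_iff.1 this
  · have : ⊤ ⇨ c ∈ P := (hf _ _).1 (by rw [h]; exact le_top)
    rwa [top_himp] at this

end Valuations

/-! ### Accessible worlds and witnesses for the modalities -/

section Modal

open BimodalGodelAlgebra

variable {A : Type u} {L : Type v} [BimodalGodelAlgebra A]

theorem BimodalGodelAlgebra.I_mono {x y : A} (h : x ≤ y) : I x ≤ I y := by
  have := I_inf x y
  rw [inf_eq_left.2 h] at this
  exact inf_eq_left.1 this.symm

theorem BimodalGodelAlgebra.K_mono {x y : A} (h : x ≤ y) : K x ≤ K y := by
  have := K_sup x y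
  rw [sup_eq_right.2 h] at this
  exact sup_eq_right.1 this.symm

theorem BimodalGodelAlgebra.K_inf_I_himp_le (a y : A) : K a ⊓ I (a ⇨ y) ≤ K y := by
  have h1 : K a ≤ K ((a ⇨ y) ⇨ y) := K_mono (by rw [le_himp_iff]; exact inf_himp_le)
  rw [← le_himp_iff]
  exact h1.trans (K_himp_le _ _)

variable [LinearOrder L] [BoundedOrder L]

/-- A world with valuation `w` may be seen with degree `β` from a world with valuation `v`. -/
def AccessibleAt (v : A → L) (β : L) (w : A → L) : Prop :=
  ∀ b, β ⊓ v (I b) ≤ w b ∧ β ⊓ w b ≤ v (K b)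

/-- The axiom `K_himp_le` yields the weak compatibility of the bounds β ⊓ v(Ix) and β ⊓ v(Kx) with
A/P, and `K_himp_I_le` with `hI` the strict one. -/
theorem exists_accessibleAt_of_primeFilter [Countable A] (hL : CountablySaturated L) {v : A → L}
    (hv : IsChainValuation v) {β : L} {P : Set A} (hP : IsPrimeFilterSet P)
    (hI : ∀ x, β ≤ v (I x) → x ∈ P) (hK : ∀ x ∈ P, β ≤ v (K x)) :
    ∃ w : A → L, IsChainValuation w ∧ AccessibleAt v β w ∧ (∀ x ∈ P, w x = ⊤) ∧
      ∀ x ∉ P, w x < β := by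
  classical
  obtain ⟨f, hf, hf'⟩ := exists_strictMono_between (L := L) (fun x y : A => x ⇨ y ∈ P) hL
    hP.himp_refl hP.himp_trans hP.himp_total (fun x => β ⊓ v (I x)) (fun x => β ⊓ v (K x))
    (by
      intro x y h
      exact le_inf inf_le_left
        (hv.le_of_le_himp ((hK _ h).trans (hv.mono (K_himp_le x y)))))
    (by
      intro x y h
      by_contra hn
      rcases inf_le_iff.1 (le_of_not_gt hn) with h1 | h1
      · exact h (hP.himp_mem_of_mem (hI _ (h1.trans inf_le_right)))
      · refine h (hI _ ?_)
        have h2 : v (K y ⇨ I x) = ⊤ := hv.map_himp_of_le (h1.trans inf_le_right)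
        exact le_top.trans (h2.ge.trans (hv.mono (K_himp_I_le y x))))
  have hfP : ∀ x ∈ P, f x = β := by
    intro x hx
    have htop : β ≤ f ⊤ := by
      have := (hf' ⊤).1
      rwa [I_top, hv.map_top, inf_top_eq] at this
    refine le_antisymm ((hf' x).2.trans inf_le_left) (htop.trans ((hf _ _).2 ?_))
    exact hP.himp_mem_of_mem hx
  have hfnP : ∀ x ∉ P, f x < β := by
    intro x hx
    rw [← hfP ⊤ hP.top_mem]
    refine lt_of_not_ge fun h => hx ?_
    have := (hf _ _).1 h
    rwa [top_himp] at this
  -- The placement `f` sends `P` to `β`, not to `⊤`. Raising that top class keeps the order, and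
  -- meets with `β` do not notice it.
  let w : A → L := fun x => if x ∈ P then ⊤ else f x
  have hwP : ∀ x ∈ P, w x = ⊤ := fun x hx => if_pos hx
  have hwn : ∀ x ∉ P, w x = f x := fun x hx => if_neg hx
  refine ⟨w, hP.isChainValuation (fun x y => ?_) ?_ hwP, fun b => ?_, hwP,
    fun x hx => (hwn x hx).trans_lt (hfnP x hx)⟩
  · by_cases hy : y ∈ P
    · simp only [hwP y hy, le_top, hP.himp_mem_of_mem hy]
    · rw [hwn y hy]
      by_cases hx : x ∈ P
      · rw [hwP x hx]
        refine iff_of_false (fun h => ?_) fun h => hy (hP.mem_of_himp_mem hx h)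
        exact absurd (hfnP y hy) (not_lt.2 (le_top.trans h))
      · rw [hwn x hx]; exact hf x y
  · rw [hwn _ hP.bot_notMem]
    have := (hf' ⊥).2
    rw [K_bot, hv.map_bot, inf_bot_eq] at this
    exact le_bot_iff.1 this
  · by_cases hb : b ∈ P
    · rw [hwP b hb]
      exact ⟨le_top, inf_le_left.trans (hK b hb)⟩
    · rw [hwn b hb]
      exact ⟨(hf' b).1, inf_le_right.trans ((hf' b).2.trans inf_le_right)⟩

/-- The degree β is taken in the gap immediately above v(Ia), below every larger value of v. Then
v(Ky) < β implies v(Ky) ≤ v(Ia), hence v(I(y ⇨ a)) = ⊤, so the filter required by β avoids the ideal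
generated by `a` and these `y`. -/
theorem exists_accessibleAt_I [Countable A] (hL : CountablySaturated L) {v : A → L}
    (hv : IsChainValuation v) {a : A} {ε : L} (hε : v (I a) < ε) :
    ∃ (w : A → L) (β : L), IsChainValuation w ∧ AccessibleAt v β w ∧ w a < β ∧ w a < ε := by
  obtain ⟨β, h1, h2⟩ := hL.exists_between_sets (s := {v (I a)})
    (t := insert ε (Set.range v ∩ {x | v (I a) < x})) (Set.countable_singleton _)
    (((Set.countable_range v).mono Set.inter_subset_left).insert _) ⟨_, rfl⟩ ⟨_, Or.inl rfl⟩ (by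
      rintro _ rfl b (rfl | hb)
      exacts [hε, hb.2])
  have hβ : v (I a) < β := h1 _ rfl
  have hβε : β < ε := h2 _ (Or.inl rfl)
  have hgap : ∀ x, v x < β → v x ≤ v (I a) := by
    intro x hx
    by_contra hn
    exact absurd (h2 _ (Or.inr ⟨⟨x, rfl⟩, not_le.1 hn⟩)) hx.not_gt
  obtain ⟨P, hP, hF, hJ⟩ := exists_isPrimeFilterSet (A := A) {x | β ≤ v (I x)}
    {x | ∃ y, v (K y) < β ∧ x ≤ y ⊔ a}
    (by simp only [Set.mem_ofPred_eq, I_top, hv.map_top]; exact le_top)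
    (fun hx h => hx.trans (hv.mono (I_mono h)))
    (fun {x y} hx hy => by
      simp only [Set.mem_ofPred_eq, I_inf, hv.map_inf]; exact le_inf hx hy)
    ⟨⊥, by rw [K_bot, hv.map_bot]; exact bot_le.trans_lt hβ, bot_le⟩
    (fun ⟨y, hy, h⟩ h' => ⟨y, hy, h'.trans h⟩)
    (fun ⟨y, hy, h⟩ ⟨z, hz, h'⟩ => ⟨y ⊔ z, by rw [K_sup, hv.map_sup]; exact sup_lt_iff.2 ⟨hy, hz⟩,
      sup_le (h.trans (sup_le_sup_right le_sup_left _))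
        (h'.trans (sup_le_sup_right le_sup_right _))⟩)
    (by
      rintro x hx ⟨y, hy, hxy⟩
      have h3 : v (I (y ⇨ a)) = ⊤ := by
        refine top_le_iff.1 (le_trans ?_ (hv.mono (K_himp_I_le y a)))
        exact (hv.map_himp_of_le (hgap _ hy)).ge
      have h4 : v (I ((y ⊔ a) ⊓ (y ⇨ a))) ≤ v (I a) := by
        refine hv.mono (I_mono ?_)
        rw [inf_sup_right]
        exact sup_le inf_himp_le inf_le_left
      rw [I_inf, hv.map_inf, h3, inf_top_eq] at h4
      exact absurd (((hx : β ≤ v (I x)).trans (hv.mono (I_mono hxy))).trans h4) (not_le.2 hβ))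
  obtain ⟨w, hw, hacc, -, hlt⟩ := exists_accessibleAt_of_primeFilter hL hv hP
    (fun x hx => hF hx) (fun x hx => le_of_not_gt fun h => hJ x hx ⟨x, h, le_sup_left⟩)
  have ha : w a < β := hlt a fun h => hJ a h
    ⟨⊥, by rw [K_bot, hv.map_bot]; exact bot_le.trans_lt hβ, le_sup_right⟩
  exact ⟨w, β, hw, hacc, ha, ha.trans hβε⟩

/-- With β = v(Ka), adding `a` to the filter required by β is harmless: z ⊓ a ≤ x gives z ≤ a ⇨ x,
and Ka ⊓ I(a ⇨ x) ≤ Kx then keeps v(Kx) at least β. -/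
theorem exists_accessibleAt_K [Countable A] (hL : CountablySaturated L) {v : A → L}
    (hv : IsChainValuation v) {a : A} (ha : v (K a) ≠ ⊥) :
    ∃ w : A → L, IsChainValuation w ∧ AccessibleAt v (v (K a)) w ∧ w a = ⊤ := by
  have hβ : ⊥ < v (K a) := bot_lt_iff_ne_bot.2 ha
  obtain ⟨P, hP, hF, hJ⟩ := exists_isPrimeFilterSet (A := A)
    {x | ∃ z, v (K a) ≤ v (I z) ∧ z ⊓ a ≤ x} {x | v (K x) < v (K a)}
    ⟨⊤, by rw [I_top, hv.map_top]; exact le_top, le_top⟩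
    (fun ⟨z, hz, h⟩ h' => ⟨z, hz, h.trans h'⟩)
    (fun ⟨y, hy, h⟩ ⟨z, hz, h'⟩ => ⟨y ⊓ z, by rw [I_inf, hv.map_inf]; exact le_inf hy hz,
      le_inf ((inf_le_inf_right _ inf_le_left).trans h)
        ((inf_le_inf_right _ inf_le_right).trans h')⟩)
    (by simpa only [Set.mem_ofPred_eq, K_bot, hv.map_bot] using hβ)
    (fun hy h => (hv.mono (K_mono h)).trans_lt hy)
    (fun {x y} hx hy => by
      simp only [Set.mem_ofPred_eq, K_sup, hv.map_sup]; exact sup_lt_iff.2 ⟨hx, hy⟩)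
    (by
      rintro x ⟨z, hz, hzx⟩ (hx : v (K x) < v (K a))
      have h1 : v (K a) ≤ v (I (a ⇨ x)) := hz.trans (hv.mono (I_mono (le_himp_iff.2 hzx)))
      have h2 := hv.mono (K_inf_I_himp_le a x)
      rw [hv.map_inf, inf_eq_left.2 h1] at h2
      exact absurd h2 (not_le.2 hx))
  obtain ⟨w, hw, hacc, htop, -⟩ := exists_accessibleAt_of_primeFilter hL hv hP
    (fun x hx => hF ⟨x, hx, inf_le_left⟩) (fun x hx => le_of_not_gt fun h => hJ x hx h)
  exact ⟨w, hw, hacc, htop a (hF ⟨⊤, by rw [I_top, hv.map_top]; exact le_top, inf_le_right⟩)⟩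

end Modal

/-! ### The frame and the embedding -/

open BimodalGodelAlgebra in
/-- A countable set of worlds, each a homomorphism into a chain labelled by a degree of
accessibility, which separates the nonunits and contains witnesses for both modalities. -/
theorem exists_countable_witnessed (A : Type u) {L : Type v} [BimodalGodelAlgebra A] [Countable A]
    [LinearOrder L] [BoundedOrder L] [Nontrivial L] (hL : CountablySaturated L) :
    ∃ C : Set ({v : A → L // IsChainValuation v} × L), C.Countable ∧
      (∀ c : A, c ≠ ⊤ → ∃ x ∈ C, x.1.1 c ≠ ⊤) ∧
      (∀ x ∈ C, ∀ a, ∃ y ∈ C, y.2 = x.1.1 a) ∧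
      (∀ x ∈ C, ∀ y ∈ C, ∀ a, x.1.1 (I a) < y.2 →
        ∃ z ∈ C, AccessibleAt x.1.1 z.2 z.1.1 ∧ z.1.1 a < z.2 ∧ z.1.1 a < y.2) ∧
      (∀ x ∈ C, ∀ a, x.1.1 (K a) ≠ ⊥ →
        ∃ z ∈ C, AccessibleAt x.1.1 z.2 z.1.1 ∧ z.2 = x.1.1 (K a) ∧ z.1.1 a = ⊤) := by
  classical
  have hroot : ∀ c : {c : A // c ≠ ⊤}, ∃ v : {v : A → L // IsChainValuation v}, v.1 c.1 ≠ ⊤ :=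
    fun c => let ⟨v, hv, h⟩ := exists_isChainValuation_ne_top hL c.2; ⟨⟨v, hv⟩, h⟩
  choose root hroot using hroot
  have hbox : ∀ (a : A) (x y : {v : A → L // IsChainValuation v} × L),
      ∃ z : {v : A → L // IsChainValuation v} × L, x.1.1 (I a) < y.2 →
        AccessibleAt x.1.1 z.2 z.1.1 ∧ z.1.1 a < z.2 ∧ z.1.1 a < y.2 := by
    intro a x y
    by_cases h : x.1.1 (I a) < y.2
    · obtain ⟨w, β, hw, h'⟩ := exists_accessibleAt_I hL x.1.2 h
      exact ⟨(⟨w, hw⟩, β), fun _ => h'⟩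
    · exact ⟨x, fun h' => (h h').elim⟩
  choose box hbox using hbox
  have hdia : ∀ (a : A) (x : {v : A → L // IsChainValuation v} × L),
      ∃ z : {v : A → L // IsChainValuation v} × L, x.1.1 (K a) ≠ ⊥ →
        AccessibleAt x.1.1 z.2 z.1.1 ∧ z.2 = x.1.1 (K a) ∧ z.1.1 a = ⊤ := by
    intro a x
    by_cases h : x.1.1 (K a) ≠ ⊥
    · obtain ⟨w, hw, h1, h2⟩ := exists_accessibleAt_K hL x.1.2 h
      exact ⟨(⟨w, hw⟩, x.1.1 (K a)), fun _ => ⟨h1, rfl, h2⟩⟩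
    · exact ⟨x, fun h' => (h h').elim⟩
  choose dia hdia using hdia
  -- Thresholds for `box` are restricted to labels of worlds, which leaves countably many binary
  -- operations. The last family relabels a world by its own values, making every value a label.
  obtain ⟨C, hSC, hC, hclosed⟩ := exists_countable_closed
    (Set.range box ∪ Set.range (fun a x _ => dia a x) ∪ Set.range (fun a x _ => (x.1, x.1.1 a)))
    (((Set.countable_range _).union (Set.countable_range _)).union (Set.countable_range _))
    (Set.range fun c => (root c, (⊥ : L))) (Set.countable_range _)
  refine ⟨C, hC, fun c hc => ⟨_, hSC ⟨⟨c, hc⟩, rfl⟩, hroot ⟨c, hc⟩⟩, fun x hx a => ?_,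
    fun x hx y hy a h => ?_, fun x hx a h => ?_⟩
  · exact ⟨_, hclosed _ (Or.inr ⟨a, rfl⟩) x hx x hx, rfl⟩
  · exact ⟨_, hclosed _ (Or.inl (Or.inl ⟨a, rfl⟩)) x hx y hy, hbox a x y h⟩
  · exact ⟨_, hclosed _ (Or.inl (Or.inr ⟨a, rfl⟩)) x hx x hx, hdia a x h⟩

theorem himp_eq_of_lt {α : Type*} [GeneralizedHeytingAlgebra α] (htotal : ∀ x y : α, x ≤ y ∨ y ≤ x)
    {x y : α} (h : y < x) : x ⇨ y = y := by
  refine le_antisymm ?_ le_himp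
  rcases htotal (x ⇨ y) x with h1 | h1
  · exact (le_inf le_rfl h1).trans himp_inf_le
  · exact absurd ((le_inf h1 le_rfl).trans himp_inf_le) h.not_ge

open BimodalGodelAlgebra in
/-- A countable nontrivial bi-modal Gödel algebra embeds into the complex algebra of a frame. -/
theorem exists_injective_bimodalGodelHom (A : Type u) [BimodalGodelAlgebra A] [Countable A]
    [Nontrivial A] :
    ∃ F : GKFrame.{u}, ∃ δ : BimodalGodelHom A F.ComplexAlgebra, Function.Injective δ.toFun := by
  classical
  let L := Filter.Germ (Filter.hyperfilter ℕ : Filter ℕ) unitInterval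
  obtain ⟨C, hC, hsep, hval, hbox, hdia⟩ :=
    exists_countable_witnessed A (L := L) germ_countablySaturated
  obtain ⟨x₀, hx₀, -⟩ := hsep ⊥ bot_ne_top
  let D : Set L := Prod.snd '' C
  have hvalD : ∀ x ∈ C, ∀ a, x.1.1 a ∈ D := fun x hx a => hval x hx a
  have htopD : (⊤ : L) ∈ D := x₀.1.2.map_top ▸ hvalD x₀ hx₀ ⊤
  obtain ⟨g, hg, hgbot, hgtop, hgcont⟩ :=
    exists_rightContinuous_embedding D (hC.image _) htopD
  have hgle : ∀ {x y}, x ∈ D → y ∈ D → (g x ≤ g y ↔ x ≤ y) := fun hx hy => hg.le_iff_le hx hy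
  have hginf : ∀ {x y}, x ∈ D → y ∈ D → g (x ⊓ y) = g x ⊓ g y := by
    intro x y hx hy
    rcases le_total x y with h | h
    · rw [inf_eq_left.2 h, inf_eq_left.2 ((hgle hx hy).2 h)]
    · rw [inf_eq_right.2 h, inf_eq_right.2 ((hgle hy hx).2 h)]
  have hgsup : ∀ {x y}, x ∈ D → y ∈ D → g (x ⊔ y) = g x ⊔ g y := by
    intro x y hx hy
    rcases le_total x y with h | h
    · rw [sup_eq_right.2 h, sup_eq_right.2 ((hgle hx hy).2 h)]
    · rw [sup_eq_left.2 h, sup_eq_left.2 ((hgle hy hx).2 h)]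
  have hinfD : ∀ {x y}, x ∈ D → y ∈ D → x ⊓ y ∈ D := by
    intro x y hx hy
    rcases le_total x y with h | h
    · rwa [inf_eq_left.2 h]
    · rwa [inf_eq_right.2 h]
  let F : GKFrame.{u} :=
    { World := C
      nonempty := ⟨⟨x₀, hx₀⟩⟩
      S := fun x y => if AccessibleAt x.1.1.1 y.1.2 y.1.1.1 then g y.1.2 else ⊥ }
  have hS : ∀ x y : C, AccessibleAt x.1.1.1 y.1.2 y.1.1.1 → F.S x y = g y.1.2 :=
    fun x y h => if_pos h
  have hS' : ∀ x y : C, ¬ AccessibleAt x.1.1.1 y.1.2 y.1.1.1 → F.S x y = ⊥ :=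
    fun x y h => if_neg h
  let d : A → F.ComplexAlgebra := fun a x => g (x.1.1.1 a)
  have hD : ∀ (x : C) a, x.1.1.1 a ∈ D := fun x a => hvalD x.1 x.2 a
  have hD2 : ∀ x : C, x.1.2 ∈ D := fun x => ⟨x.1, x.2, rfl⟩
  let δ : BimodalGodelHom A F.ComplexAlgebra :=
    { toFun := d
      map_sup' := by
        intro a b
        funext x
        change g _ = g _ ⊔ g _
        rw [x.1.1.2.map_sup, hgsup (hD x a) (hD x b)]
      map_inf' := by
        intro a b
        funext x
        change g _ = g _ ⊓ g _
        rw [x.1.1.2.map_inf, hginf (hD x a) (hD x b)]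
      map_bot' := by
        funext x
        change g _ = ⊥
        rw [x.1.1.2.map_bot, hgbot]
      map_himp' := by
        intro a b
        funext x
        change g _ = g _ ⇨ g _
        rcases le_or_gt (x.1.1.1 a) (x.1.1.1 b) with h | h
        · rw [x.1.1.2.map_himp_of_le h, hgtop]
          exact (himp_eq_top_iff.2 ((hgle (hD x a) (hD x b)).2 h)).symm
        · rw [x.1.1.2.map_himp_of_lt h]
          exact (himp_eq_of_lt le_total (hg (hD x b) (hD x a) h)).symm
      map_I := by
        intro a
        funext x
        change g (x.1.1.1 (I a)) = ⨅ y : C, (F.S x y ⇨ g (y.1.1.1 a))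
        refine le_antisymm (le_iInf fun y => ?_) ?_
        · rw [le_himp_iff]
          by_cases h : AccessibleAt x.1.1.1 y.1.2 y.1.1.1
          · rw [hS x y h, inf_comm, ← hginf (hD2 y) (hD x _)]
            exact (hgle (hinfD (hD2 y) (hD x _)) (hD y a)).2 (h a).1
          · rw [hS' x y h, inf_bot_eq]
            exact bot_le
        · by_cases htop : x.1.1.1 (I a) = ⊤
          · rw [htop, hgtop]
            exact le_top
          · refine le_of_forall_gt fun s hs => ?_
            -- Right continuity turns the real bound `s` into a threshold that is the label of a
            -- world `y`, as the box witness requires. The witness has `z.1.1 a` below its own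
            -- label, so the implication takes the value `g (z.1.1 a)`.
            obtain ⟨_, ⟨y, hy, rfl⟩, hlt, hcont⟩ := hgcont _ (hD x (I a)) htop s hs
            obtain ⟨z, hz, hacc, hz1, hz2⟩ := hbox x.1 x.2 y hy a hlt
            refine (iInf_le (fun y : C => F.S x y ⇨ g (y.1.1.1 a)) ⟨z, hz⟩).trans_lt ?_
            change F.S x ⟨z, hz⟩ ⇨ g (z.1.1 a) < s
            rw [hS x ⟨z, hz⟩ hacc, himp_eq_of_lt le_total (hg (hvalD z hz a) ⟨z, hz, rfl⟩ hz1)]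
            exact hcont _ hz2
      map_K := by
        intro a
        funext x
        change g (x.1.1.1 (K a)) = ⨆ y : C, (F.S x y ⊓ g (y.1.1.1 a))
        refine le_antisymm ?_ (iSup_le fun y => ?_)
        · by_cases hbot : x.1.1.1 (K a) = ⊥
          · rw [hbot, hgbot]
            exact bot_le
          · obtain ⟨z, hz, hacc, hz1, hz2⟩ := hdia x.1 x.2 a hbot
            refine le_trans (le_of_eq ?_)
              (le_iSup (fun y : C => F.S x y ⊓ g (y.1.1.1 a)) ⟨z, hz⟩)
            change _ = F.S x ⟨z, hz⟩ ⊓ g (z.1.1 a)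
            rw [hS x ⟨z, hz⟩ hacc, hz2, hgtop, inf_top_eq]
            exact congrArg g hz1.symm
        · by_cases h : AccessibleAt x.1.1.1 y.1.2 y.1.1.1
          · rw [hS x y h, ← hginf (hD2 y) (hD y a)]
            exact (hgle (hinfD (hD2 y) (hD y a)) (hD x _)).2 (h a).2
          · rw [hS' x y h, bot_inf_eq]
            exact bot_le }
  refine ⟨F, δ, fun a b hab => ?_⟩
  have hv : ∀ x : C, x.1.1.1 a = x.1.1.1 b := fun x =>
    hg.injOn (hD x a) (hD x b) (congrFun hab x)
  -- If `c ≤ c'` failed, some world would separate `c ⇨ c'` from `⊤`, although equal values at `c`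
  -- and `c'` force `⊤` there.
  have key : ∀ c c' : A, (∀ x : C, x.1.1.1 c = x.1.1.1 c') → c ≤ c' := by
    intro c c' h
    by_contra hn
    obtain ⟨x, hx, hne⟩ := hsep (c ⇨ c') fun h' => hn (himp_eq_top_iff.1 h')
    exact hne (x.1.2.map_himp_of_le (h ⟨x, hx⟩).le)
  exact le_antisymm (key a b hv) (key b a fun x => (hv x).symm)

/-- The value of a formula in the model induced by a homomorphism into the complex algebra is the
image of its value in the algebra. -/
theorem GKModel.value_of_hom {A : Type u} [BimodalGodelAlgebra A] {F : GKFrame.{v}} {Var : Type w}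
    (δ : BimodalGodelHom A F.ComplexAlgebra) (val : Var → A) (φ : BimodalFormula Var) :
    ∀ x : F.World, (GKModel.mk F fun x p => δ.toFun (val p) x).value x φ =
      δ.toFun (φ.eval val) x := by
  induction φ with
  | var p => exact fun x => rfl
  | bot => exact fun x => (congrFun δ.map_bot' x).symm
  | and φ ψ ih1 ih2 =>
    intro x
    simp only [GKModel.value, BimodalFormula.eval, ih1, ih2]
    exact (congrFun (δ.map_inf' _ _) x).symm
  | or φ ψ ih1 ih2 =>
    intro x
    simp only [GKModel.value, BimodalFormula.eval, ih1, ih2]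
    exact (congrFun (δ.map_sup' _ _) x).symm
  | imp φ ψ ih1 ih2 =>
    intro x
    simp only [GKModel.value, BimodalFormula.eval, ih1, ih2]
    exact (congrFun (δ.map_himp' _ _) x).symm
  | box φ ih =>
    intro x
    simp only [GKModel.value, BimodalFormula.eval, ih]
    exact (congrFun (δ.map_I _) x).symm
  | dia φ ih =>
    intro x
    simp only [GKModel.value, BimodalFormula.eval, ih]
    exact (congrFun (δ.map_K _) x).symm

theorem mainTheorem3 (A : Type u) [BimodalGodelAlgebra A] [Countable A] [Nontrivial A] :
    ∃ F : GKFrame.{u},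
      (∃ δ : BimodalGodelHom A F.ComplexAlgebra, Function.Injective δ.toFun) ∧
      ∀ (Var : Type w) (val : Var → A), ∃ e : F.World → Var → unitInterval,
        ∀ φ : BimodalFormula Var,
          φ.eval val = ⊤ ↔ (GKModel.mk F e).Valid φ := by
  obtain ⟨F, δ, hδ⟩ := exists_injective_bimodalGodelHom A
  refine ⟨F, ⟨δ, hδ⟩, fun Var val => ⟨fun x p => δ.toFun (val p) x, fun φ => ?_⟩⟩
  have htop : δ.toFun ⊤ = fun _ => 1 := map_top δ.toHeytingHom
  constructor
  · intro h x
    rw [GKModel.value_of_hom, h, htop]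
  · intro h
    refine hδ (htop ▸ funext fun x => ?_)
    rw [← GKModel.value_of_hom]
    exact h x
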